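/- Let $\mathbb F$ be $\mathbb R$ or $\mathbb C$. Let $\Gamma$ be a $*$-semigroupoid with set of symbols $S$, domain and codomain maps $d,c\colon\Gamma\to S$, and involution $\alpha\mapsto\alpha^*$: the product $\alpha\beta$ is defined exactly when $d(\alpha)=c(\beta)$, it satisfies $d(\alpha\beta)=d(\beta)$ and $c(\alpha\beta)=c(\alpha)$ and is associative, and $d(\alpha^*)=c(\alpha)$, $c(\alpha^*)=d(\alpha)$, $(\alpha\beta)^*=\beta^*\alpha^*$, $\alpha^{**}=\alpha$; no units are required. Let $\Gamma$ act from the left on a set $X$ with surjective anchor map $a\colon X\to S$: $\alpha\cdot x\in X$ is defined exactly when $d(\alpha)=a(x)$, $a(\alpha\cdot x)=c(\alpha)$ and $(\alpha\beta)\cdot x=\alpha\cdot(\beta\cdot x)$. Put $X_s=a^{-1}(\{s\})$ for $s\in S$. Let $\{\mathcal H_x\}_{x\in X}$ be a bundle of Hilbert spaces over $\mathbb F$ such that $\mathcal H_{\alpha\cdot x}=\mathcal H_x$ whenever $d(\alpha)=a(x)$. An operator valued kernel $K$ assigns to all $x,y\in X$ a bounded operator $K(x,y)\colon\mathcal H_y\to\mathcal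 H_x$. It is partially Hermitian if $K(x,y)^*=K(y,x)$ for all $s\in S$ and $x,y\in X_s$; a partially Hermitian kernel $L$ is partially positive semidefinite if $\sum_{i,j=1}^n\langle L(x_j,x_i)h_i,h_j\rangle\ge 0$ for all $s\in S$, $n\in\mathbb N$, $x_1,\dots,x_n\in X_s$ and $h_i\in\mathcal H_{x_i}$. The kernel $K$ is $\Gamma$-invariant if $K(\alpha\cdot x,y)=K(x,\alpha^*\cdot y)$ for all $x,y\in X$ and all $\alpha\in\Gamma$ with $d(\alpha)=a(x)$ and $c(\alpha)=a(y)$. For $s\in S$ let $K^s$ be the restriction of $K$ to $X_s\times X_s$ and, for $x\in X_s$ and $h\in\mathcal H_x$, let $K^s_xh=(K(y,x)h)_{y\in X_s}\in\prod_{y\in X_s}\mathcal H_y$. A Krein space is a vector space over $\mathbb F$ with an inner product $[\cdot,\cdot]$ (linear in the first variable, (conjugate) symmetric, possibly indefinite) for which there is a linear operator $J$ with $J^2=I$ such that $[J\cdot,\cdot]$ is a positive definite inner product turning the space into a Hilbert space. The topology of the latter, the strong topology, does not depend on $J$; density, closed spans and boundedness of operators refer to it. A reproducing kernel Krein space with kernel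 $K^s$ is a Krein space $\mathcal R_{K^s}$ that is a linear subspace of $\prod_{y\in X_s}\mathcal H_y$, contains all $K^s_xh$ with $x\in X_s$ and $h\in\mathcal H_x$, and satisfies $\langle f(x),h\rangle_{\mathcal H_x}=[f,K^s_xh]$ for all $f\in\mathcal R_{K^s}$, $x\in X_s$, $h\in\mathcal H_x$. For a bundle $\{\mathcal K_s\}_{s\in S}$ of Krein spaces and a bundle $\{\mathcal D_s\}_{s\in S}$ of dense subspaces $\mathcal D_s\subseteq\mathcal K_s$, a generalised (unbounded) $*$-representation of $\Gamma$ on them assigns to each $\alpha\in\Gamma$ a linear operator $\Phi(\alpha)\colon\mathcal D_{d(\alpha)}\to\mathcal K_{c(\alpha)}$ with $\Phi(\alpha)\mathcal D_{d(\alpha)}\subseteq\mathcal D_{c(\alpha)}$ and such that the Krein space adjoint $\Phi(\alpha)^\sharp$ is defined on $\mathcal D_{c(\alpha)}$ and maps it into $\mathcal D_{d(\alpha)}$, in such a way that $\Phi(\alpha\beta)=\Phi(\alpha)\Phi(\beta)$ on $\mathcal D_{d(\beta)}$ whenever $d(\alpha)=c(\beta)$, and $\Phi(\alpha^*)=\Phi(\alpha)^\sharp|_{\mathcal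 D_{c(\alpha)}}$ for all $\alpha\in\Gamma$. **Theorem.** For a partially Hermitian operator valued kernel $K$ the following assertions are equivalent. (1) $K$ is $\Gamma$-invariant and there is a partially positive semidefinite kernel $L$ such that $L-K$ is partially positive semidefinite. (2) There exist reproducing kernel Krein spaces $\mathcal R_{K^s}$ with kernel $K^s$, $s\in S$, and, with $\mathcal D_s$ the linear span of $\{K^s_xh\mid x\in X_s,\ h\in\mathcal H_x\}$, a generalised $*$-representation $\Phi$ of $\Gamma$ on the bundles $\{\mathcal R_{K^s}\}_{s\in S}$ and $\{\mathcal D_s\}_{s\in S}$ such that $\Phi(\alpha)K^{d(\alpha)}_xh=K^{c(\alpha)}_{\alpha\cdot x}h$ for all $\alpha\in\Gamma$, $x\in X_{d(\alpha)}$ and $h\in\mathcal H_x$. (3) There exist a bundle $\{\mathcal K_s\}_{s\in S}$ of Krein spaces, a bundle $\{\mathcal D_s\}_{s\in S}$ of dense subspaces $\mathcal D_s\subseteq\mathcal K_s$, bounded linear operators $V_x\colon\mathcal H_x\to\mathcal K_{a(x)}$, $x\in X$, and a generalised $*$-representation $\Phi$ of $\Gamma$ on the bundles $\{\mathcal K_s\}_{s\in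 S}$ and $\{\mathcal D_s\}_{s\in S}$, such that $\langle K(x,y)k,h\rangle_{\mathcal H_x}=[V_yk,V_xh]_{\mathcal K_s}$ for all $s\in S$, $x,y\in X_s$, $h\in\mathcal H_x$, $k\in\mathcal H_y$, such that $\mathcal K_s$ is the closed linear span of $\bigcup_{x\in X_s}V_x\mathcal H_x$ for all $s\in S$, and such that $\Phi(\alpha)V_x=V_{\alpha\cdot x}$ for all $x\in X$ and all $\alpha\in\Gamma$ with $d(\alpha)=a(x)$ (in particular, $V_x\mathcal H_x\subseteq\mathcal D_{a(x)}$ for such $x$ and $\alpha$). -/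

import Mathlib

universe u v w

/-- A Hilbert space over `𝕜`, bundled, so that a bundle of Hilbert spaces with base `X` is a map
`X → HilbertSpc 𝕜`, and `H x = H y` says that the two fibres are the same Hilbert space. -/
structure HilbertSpc (𝕜 : Type u) [RCLike 𝕜] : Type (max u (w + 1)) where
  carrier : Type w
  [normedAddCommGroup : NormedAddCommGroup carrier]
  [innerProductSpace : InnerProductSpace 𝕜 carrier]
  [completeSpace : CompleteSpace carrier]

namespace HilbertSpc

variable {𝕜 : Type u} [RCLike 𝕜]

instance : CoeSort (HilbertSpc.{u, w} 𝕜) (Type w) := ⟨HilbertSpc.carrier⟩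

attribute [instance] HilbertSpc.normedAddCommGroup HilbertSpc.innerProductSpace
  HilbertSpc.completeSpace

/-- The identity map between two Hilbert spaces that are equal. -/
def cast {A B : HilbertSpc.{u, w} 𝕜} (h : A = B) : A ≃ₗᵢ[𝕜] B :=
  h ▸ LinearIsometryEquiv.refl 𝕜 A

end HilbertSpc

/-! ### Semigroupoids with involution and their left actions -/

/-- A semigroupoid on `Γ` with set of symbols `S`. The product `α β` is defined exactly
for the composable pairs, that is, when `dom α = cod β`. -/
structure Semigroupoid (Γ : Type*) (S : Type*) where
  dom : Γ → S
  cod : Γ → S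
  mul : ∀ α β : Γ, dom α = cod β → Γ
  dom_mul : ∀ α β h, dom (mul α β h) = dom β
  cod_mul : ∀ α β h, cod (mul α β h) = cod α
  mul_assoc : ∀ (α β γ : Γ) (h₁ : dom α = cod β) (h₂ : dom β = cod γ),
    mul α (mul β γ h₂) (h₁.trans (cod_mul β γ h₂).symm) =
      mul (mul α β h₁) γ ((dom_mul α β h₁).trans h₂)

/-- A semigroupoid with a specified involution. -/
structure StarSemigroupoid (Γ : Type*) (S : Type*) extends Semigroupoid Γ S where
  star : Γ → Γ
  dom_star : ∀ α, dom (star α) = cod α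
  cod_star : ∀ α, cod (star α) = dom α
  star_mul : ∀ (α β : Γ) (h : dom α = cod β),
    star (mul α β h) = mul (star β) (star α) ((dom_star β).trans (h.symm.trans (cod_star α).symm))
  star_star : ∀ α, star (star α) = α

namespace Semigroupoid

variable {Γ S : Type*} (G : Semigroupoid Γ S)

/-- The fibre `Γ_s^t` of the elements with domain `s` and codomain `t`. -/
abbrev Hom (s t : S) : Type _ := {α : Γ // G.dom α = s ∧ G.cod α = t}

variable {G}

/-- The product as a map `Γ_t^r × Γ_s^t → Γ_s^r`. -/
def Hom.comp {s t r : S} (α : G.Hom t r) (β : G.Hom s t) : G.Hom s r :=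
  ⟨G.mul α.1 β.1 (α.2.1.trans β.2.2.symm),
    (G.dom_mul _ _ _).trans β.2.1, (G.cod_mul _ _ _).trans α.2.2⟩

end Semigroupoid

/-- The involution as a map `Γ_s^t → Γ_t^s`. -/
def StarSemigroupoid.starHom {Γ S : Type*} (G : StarSemigroupoid Γ S) {s t : S}
    (α : G.Hom s t) : G.Hom t s :=
  ⟨G.star α.1, (G.dom_star _).trans α.2.2, (G.cod_star _).trans α.2.1⟩

/-- A left action of a semigroupoid on `X`. The element `α · x` is defined exactly
when `dom α = anchor x`. -/
structure LeftAction {Γ S : Type*} (G : Semigroupoid Γ S) (X : Type*) where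
  anchor : X → S
  anchor_surjective : Function.Surjective anchor
  act : ∀ (α : Γ) (x : X), G.dom α = anchor x → X
  anchor_act : ∀ α x h, anchor (act α x h) = G.cod α
  act_mul : ∀ (α β : Γ) (x : X) (h₁ : G.dom α = G.cod β) (h₂ : G.dom β = anchor x),
    act (G.mul α β h₁) x ((G.dom_mul α β h₁).trans h₂) =
      act α (act β x h₂) (h₁.trans (anchor_act β x h₂).symm)

namespace LeftAction

variable {Γ S : Type*} {G : Semigroupoid Γ S} {X : Type*} (A : LeftAction G X)

/-- The set `X_s` of the points with anchor `s`. -/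
abbrev Fiber (s : S) : Type _ := {x : X // A.anchor x = s}

/-- The action as a map `Γ_s^t × X_s → X_t`. -/
def smul {s t : S} (α : G.Hom s t) (x : A.Fiber s) : A.Fiber t :=
  ⟨A.act α.1 x.1 (α.2.1.trans x.2.symm), (A.anchor_act _ _ _).trans α.2.2⟩

/-- The fibres of the bundle `H` are the same along every orbit: `H_{α · x} = H_x`. -/
def ConstOnOrbits {𝕜 : Type u} [RCLike 𝕜] (H : X → HilbertSpc.{u, w} 𝕜) : Prop :=
  ∀ ⦃s t : S⦄ (α : G.Hom s t) (x : A.Fiber s), H (A.smul α x).1 = H x.1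

end LeftAction

/-! ### Operator valued kernels -/

/-- Operator valued kernels: `K x y` is a bounded linear operator from `H y` to `H x`. -/
abbrev OpKernel {𝕜 : Type u} [RCLike 𝕜] {X : Type v} (H : X → HilbertSpc.{u, w} 𝕜) :
    Type (max v w) :=
  ∀ x y : X, H y →L[𝕜] H x

namespace OpKernel

variable {𝕜 : Type u} [RCLike 𝕜] {X : Type v} {H : X → HilbertSpc.{u, w} 𝕜}

/-- For `h ∈ H x`, the section `K_x h = K(·, x) h` of the bundle. -/
def sec (K : OpKernel H) (x : X) : H x →ₗ[𝕜] (∀ y, H y) :=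
  LinearMap.pi fun y => (K y x : H x →ₗ[𝕜] H y)

variable {Γ S : Type*}

/-- The restriction `K^s` of `K` to `X_s × X_s`. -/
def restrict {G : Semigroupoid Γ S} (K : OpKernel H) (A : LeftAction G X) (s : S) :
    OpKernel (fun x : A.Fiber s => H x.1) :=
  fun x y => K x.1 y.1

/-- Partially Hermitian, with respect to the partition of `X` by the anchor map. -/
def PartiallyHermitian {G : Semigroupoid Γ S} (K : OpKernel H) (A : LeftAction G X) : Prop :=
  ∀ (s : S) (x y : A.Fiber s), ContinuousLinearMap.adjoint (K x.1 y.1) = K y.1 x.1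

/-- Partially positive semidefinite, with respect to the partition of `X` by the anchor map.
The kernel is required to be partially Hermitian, so the double sum is a real number. -/
def PartiallyPosSemidef {G : Semigroupoid Γ S} (K : OpKernel H) (A : LeftAction G X) : Prop :=
  K.PartiallyHermitian A ∧
    ∀ (s : S) (n : ℕ) (x : Fin n → A.Fiber s) (h : ∀ i, H (x i).1),
      0 ≤ RCLike.re (∑ i, ∑ j, inner 𝕜 (h j) (K (x j).1 (x i).1 (h i)))

/-- `K` is partially dominated by `L`: the kernel `L - K` is partially positive semidefinite. -/
def PartiallyDominatedBy {G : Semigroupoid Γ S} (K L : OpKernel H) (A : LeftAction G X) : Prop :=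
  OpKernel.PartiallyPosSemidef (H := H) (fun x y => L x y - K x y) A

/-- `K` is `Γ`-invariant: `K(α · x, y) = K(x, α^* · y)` for all `x`, `y` and all `α` with domain
the anchor of `x` and codomain the anchor of `y`; the two sides are compared through the
equalities `H_{α · x} = H_x` and `H_{α^* · y} = H_y`. -/
def Invariant {G : StarSemigroupoid Γ S} (K : OpKernel H) (A : LeftAction G.toSemigroupoid X)
    (hH : A.ConstOnOrbits H) : Prop :=
  ∀ ⦃s t : S⦄ (α : G.Hom s t) (x : A.Fiber s) (y : A.Fiber t) (k : H y.1),
    HilbertSpc.cast (hH α x) (K (A.smul α x).1 y.1 k) =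
      K x.1 (A.smul (G.starHom α) y).1 (HilbertSpc.cast (hH (G.starHom α) y).symm k)

end OpKernel

/-! ### Krein spaces -/

section Krein

variable {𝕜 : Type u} [RCLike 𝕜]

/-- `J² = I`, and `⟨x, y⟩_J = [J x, y]` is a positive definite inner product that makes `V` a
Hilbert space, with topology `τ`. (The inner product of `InnerProductSpace.Core` is linear in the
second variable, the form `[·,·]` is linear in the first one.) -/
def IsFundamentalSymmetry {V : Type v} [AddCommGroup V] [Module 𝕜 V]
    (form : V →ₗ[𝕜] V →ₗ⋆[𝕜] 𝕜) (τ : TopologicalSpace V) (J : V →ₗ[𝕜] V) : Prop :=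
  J ∘ₗ J = LinearMap.id ∧
    ∃ c : InnerProductSpace.Core 𝕜 V, (∀ x y, c.inner y x = form (J x) y) ∧
      letI : NormedAddCommGroup V := c.toNormedAddCommGroup
      CompleteSpace V ∧ τ = UniformSpace.toTopologicalSpace

/-- The structure of a Krein space on the vector space `V`: an inner product `[·,·]`, linear in the
first variable and conjugate symmetric, for which a fundamental symmetry exists. All fundamental
symmetries of `[·,·]` give the same topology, the strong topology, which is recorded here; it is
thus determined by the form. -/
structure KreinStructure (𝕜 : Type u) [RCLike 𝕜] (V : Type v) [AddCommGroup V] [Module 𝕜 V] where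
  form : V →ₗ[𝕜] V →ₗ⋆[𝕜] 𝕜
  form_symm : ∀ x y, form x y = starRingEnd 𝕜 (form y x)
  strongTopology : TopologicalSpace V
  exists_fundamentalSymmetry : ∃ J : V →ₗ[𝕜] V, IsFundamentalSymmetry form strongTopology J

/-- Density of a subspace in the strong topology. -/
def KreinStructure.IsDense {V : Type v} [AddCommGroup V] [Module 𝕜 V] (κ : KreinStructure 𝕜 V)
    (D : Submodule 𝕜 V) : Prop :=
  @Dense V κ.strongTopology (D : Set V)

variable {V₁ : Type*} {V₂ : Type*} [AddCommGroup V₁] [Module 𝕜 V₁] [AddCommGroup V₂] [Module 𝕜 V₂]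

/-- The graph of the Krein space adjoint `T^♯` of an operator `T` with domain `D`:
`y` belongs to the domain of `T^♯` and `T^♯ y = z`. If `D` is dense then `z` is unique. -/
def IsSharp (κ₁ : KreinStructure 𝕜 V₁) (κ₂ : KreinStructure 𝕜 V₂) {D : Submodule 𝕜 V₁}
    (T : D →ₗ[𝕜] V₂) (y : V₂) (z : V₁) : Prop :=
  ∀ h : D, κ₂.form (T h) y = κ₁.form (h : V₁) z

/-- The operators in `L^♯(D₁, D₂)`: `T D₁ ⊆ D₂`, `D₂ ⊆ dom T^♯` and `T^♯ D₂ ⊆ D₁`. -/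
structure MemSharp (κ₁ : KreinStructure 𝕜 V₁) (κ₂ : KreinStructure 𝕜 V₂)
    (D₁ : Submodule 𝕜 V₁) (D₂ : Submodule 𝕜 V₂) (T : D₁ →ₗ[𝕜] V₂) : Prop where
  maps : ∀ f, T f ∈ D₂
  sharp : ∀ y ∈ D₂, ∃ z ∈ D₁, IsSharp κ₁ κ₂ T y z

/-- A generalised (unbounded) `*`-representation `(Id_S, Φ)` of `Γ` on the bundle of Krein spaces
`𝒦` with the bundle `D` of dense subspaces: `Φ(α) ∈ L^♯(D_s, D_t)` for `α ∈ Γ_s^t`, the map `Φ`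
is multiplicative, and `Φ(α^*)` is the restriction of `Φ(α)^♯` to `D_t`. -/
structure GenStarRep {Γ S : Type*} (G : StarSemigroupoid Γ S) {𝒦 : S → Type*}
    [∀ s, AddCommGroup (𝒦 s)] [∀ s, Module 𝕜 (𝒦 s)] (κ : ∀ s, KreinStructure 𝕜 (𝒦 s))
    (D : ∀ s, Submodule 𝕜 (𝒦 s)) where
  dense : ∀ s, (κ s).IsDense (D s)
  op : ∀ {s t : S}, G.Hom s t → (D s →ₗ[𝕜] 𝒦 t)
  op_memSharp : ∀ {s t : S} (α : G.Hom s t), MemSharp (κ s) (κ t) (D s) (D t) (op α)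
  op_comp : ∀ {s t r : S} (α : G.Hom t r) (β : G.Hom s t) (f : D s),
    op (α.comp β) f = op α ⟨op β f, (op_memSharp β).maps f⟩
  op_star : ∀ {s t : S} (α : G.Hom s t) (y : D t),
    IsSharp (κ s) (κ t) (op α) (y : 𝒦 t) (op (G.starHom α) y)

end Krein

/-! ### Reproducing kernel Krein spaces and Krein space partial linearisations -/

section Linearisations

variable {𝕜 : Type u} [RCLike 𝕜] {X : Type v} {H : X → HilbertSpc.{u, w} 𝕜}

/-- A reproducing kernel Krein space of sections of `H`, with reproducing kernel `K`. -/
structure RKKreinSpace (K : OpKernel H) where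
  space : Submodule 𝕜 (∀ x, H x)
  krein : KreinStructure 𝕜 space
  sec_mem : ∀ (x : X) (h : H x), K.sec x h ∈ space
  reproducing : ∀ (f : space) (x : X) (h : H x),
    inner 𝕜 h (f.1 x) = krein.form f ⟨K.sec x h, sec_mem x h⟩

namespace RKKreinSpace

variable {K : OpKernel H} (R : RKKreinSpace K)

/-- The operator `K_x`, from `H x` to the reproducing kernel Krein space. -/
def sec (x : X) : H x →ₗ[𝕜] R.space := (K.sec x).codRestrict R.space (R.sec_mem x)

/-- The linear span of all the `K_x h`. -/
def secSpan : Submodule 𝕜 R.space := Submodule.span 𝕜 {f | ∃ (x : X) (h : H x), f = R.sec x h}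

theorem sec_mem_secSpan (x : X) (h : H x) : R.sec x h ∈ R.secSpan :=
  Submodule.subset_span ⟨x, h, rfl⟩

end RKKreinSpace

/-- A minimal Krein space partial linearisation of `K` on the bundle of Krein spaces `𝒦`: bounded
operators `V x` from `H x` to `𝒦 s`, for `x ∈ X_s`, such that `K(x, y) = V_x^♯ V_y` for all
`x, y ∈ X_s`, and such that `𝒦 s` is the closed span of the ranges of the `V x` with `x ∈ X_s`. -/
structure MinimalKreinLinearisation {Γ S : Type*} {G : Semigroupoid Γ S} (A : LeftAction G X)
    (K : OpKernel H) {𝒦 : S → Type*} [∀ s, AddCommGroup (𝒦 s)] [∀ s, Module 𝕜 (𝒦 s)]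
    (κ : ∀ s, KreinStructure 𝕜 (𝒦 s)) where
  V : ∀ {s : S} (x : A.Fiber s), H x.1 →ₗ[𝕜] 𝒦 s
  bounded : ∀ {s : S} (x : A.Fiber s), @Continuous (H x.1) (𝒦 s) inferInstance (κ s).strongTopology (V x)
  kernel_eq : ∀ {s : S} (x y : A.Fiber s) (h : H x.1) (k : H y.1),
    inner 𝕜 h (K x.1 y.1 k) = (κ s).form (V y k) (V x h)
  minimal : ∀ s : S, (κ s).IsDense
    (Submodule.span 𝕜 {f | ∃ (x : A.Fiber s) (h : H x.1), f = V x h})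

end Linearisations

/-!
The equivalence rests on Krein space factorisations of the kernel on each fibre `X_s`.

*Domination gives a Krein space.* If `L` and `L - K` are positive semidefinite on `X_s`, their
Kolmogorov decompositions (`OpKernel.exists_kolmogorov`) combine to `K(x, y) = W_x^* J₀ W_y` on a
direct sum of two Hilbert spaces, with `J₀ = 1 ⊕ (-1)`. The closed span of the ranges of the `W_x`
need not be a Krein space for the form of `J₀`, so `J₀` is compressed to it: this gives a
self-adjoint contraction `A` with polar decomposition `A = J |A|`. Then `V_x = |A|^{1/2} W_x`
satisfies `K(x, y) = V_x^* J V_y`, and `J` is a symmetry of the closed span of the ranges of the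
`V_x` (`OpKernel.exists_linearisation`). The image of this Krein space under `f ↦ (V_y^* J f)_y` is
a reproducing kernel Krein space in which the span of the sections `K_x h` is dense
(`OpKernel.exists_rkKreinSpace_of_linearisation`). The square roots are sums of binomial series
(`ContinuousLinearMap.exists_isSelfAdjoint_sqrt`), which treats real and complex scalars alike.

*Invariance gives the representation.* The operator `f ↦ (f(α^* · y))_y` is defined on all sections
and multiplicative in `α`; invariance of `K` says that it maps `K_x h` to `K_{α · x} h`, and the
reproducing property that it is adjoint to the operator of `α^*`
(`OpKernel.Invariant.genStarRep`).

*Conversely*, a reproducing kernel Krein space is a linearisation with `V_x h = K_x h`, where `V_x`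
is bounded by the closed graph theorem (`KreinStructure.continuous_of_adjoint`). For a linearisation,
`[Φ(α) V_x h, V_y k] = [V_x h, Φ(α^*) V_y k]` is the invariance of `K`, and `L(x, y) = V_x^* V_y`,
with Hilbert space adjoints for a fundamental symmetry, dominates `K`
(`MinimalKreinLinearisation.exists_dominating`).
-/

/-! ### Square roots and polar decompositions of self-adjoint operators -/

/-- The coefficients `cₙ` of the power series `1 - √(1 - t) = ∑ cₙ tⁿ`, in terms of the Catalan
numbers. -/
noncomputable def sqrtCoeff : ℕ → ℝ
  | 0 => 0
  | n + 1 => catalan n / (2 * 4 ^ n)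

theorem sqrtCoeff_nonneg (n : ℕ) : 0 ≤ sqrtCoeff n := by
  cases n <;> simp only [sqrtCoeff] <;> positivity

/-- The identity `(∑ cₙ tⁿ)² = 2 ∑ cₙ tⁿ - t` of formal power series, coefficient by coefficient:
this is the recursion of the Catalan numbers. -/
theorem sum_antidiagonal_sqrtCoeff (n : ℕ) :
    ∑ p ∈ Finset.HasAntidiagonal.antidiagonal n, sqrtCoeff p.1 * sqrtCoeff p.2 =
      2 * sqrtCoeff n - if n = 1 then 1 else 0 := by
  match n with
  | 0 => simp [sqrtCoeff]
  | 1 => simp [sqrtCoeff, Finset.Nat.antidiagonal_succ]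
  | n + 2 =>
    rw [Finset.Nat.sum_antidiagonal_succ, Finset.Nat.sum_antidiagonal_succ']
    simp only [sqrtCoeff, zero_mul, mul_zero, zero_add]
    rw [catalan_succ', if_neg (by omega)]
    push_cast
    rw [sub_zero, Finset.sum_div, Finset.mul_sum]
    refine Finset.sum_congr rfl fun p hp => ?_
    rw [← Finset.HasAntidiagonal.mem_antidiagonal.1 hp]
    field_simp
    ring

theorem sum_range_sqrtCoeff (N : ℕ) :
    ∑ n ∈ Finset.range (N + 1), sqrtCoeff n = 1 - N.centralBinom / 4 ^ N := by
  induction N with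
  | zero => simp [sqrtCoeff]
  | succ N ih =>
    have h1 : ((N : ℝ) + 1) * catalan N = N.centralBinom := by
      exact_mod_cast succ_mul_catalan_eq_centralBinom N
    have h2 : ((N : ℝ) + 1) * (N + 1).centralBinom = 2 * (2 * N + 1) * N.centralBinom := by
      exact_mod_cast Nat.succ_mul_centralBinom_succ N
    have h3 : ((N + 1).centralBinom : ℝ) = 2 * (2 * N + 1) * catalan N := by
      have : (N : ℝ) + 1 ≠ 0 := by positivity
      apply mul_left_cancel₀ this
      rw [h2, ← h1]; ring
    rw [Finset.sum_range_succ, ih, h3, ← h1, sqrtCoeff]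
    field_simp
    ring

theorem sum_range_sqrtCoeff_le_one (N : ℕ) : ∑ n ∈ Finset.range N, sqrtCoeff n ≤ 1 := by
  cases N with
  | zero => simp
  | succ N =>
    rw [sum_range_sqrtCoeff]
    have : 0 ≤ (N.centralBinom : ℝ) / 4 ^ N := by positivity
    linarith

theorem summable_sqrtCoeff : Summable sqrtCoeff :=
  summable_of_sum_range_le sqrtCoeff_nonneg sum_range_sqrtCoeff_le_one

theorem tsum_sqrtCoeff_le_one : ∑' n, sqrtCoeff n ≤ 1 :=
  summable_sqrtCoeff.tsum_le_of_sum_range_le sum_range_sqrtCoeff_le_one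

namespace ContinuousLinearMap

variable {𝕜 E : Type*} [RCLike 𝕜] [NormedAddCommGroup E] [InnerProductSpace 𝕜 E] [CompleteSpace E]

/-- The square root of a self-adjoint operator `T` with `‖1 - T‖ ≤ 1` (so that `0 ≤ T`), as the sum
of the binomial series of `√(1 - (1 - T))`. The continuous functional calculus is not used, so that
real and complex scalars are treated alike. -/
theorem exists_isSelfAdjoint_sqrt {T : E →L[𝕜] E} (hT : IsSelfAdjoint T) (hT1 : ‖1 - T‖ ≤ 1) :
    ∃ Q : E →L[𝕜] E, IsSelfAdjoint Q ∧ ‖1 - Q‖ ≤ 1 ∧ Q * Q = T ∧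
      ∀ C : E →L[𝕜] E, Commute C T → Commute C Q := by
  set B := 1 - T with hB
  have hBs : IsSelfAdjoint B := (IsSelfAdjoint.one _).sub hT
  set f : ℕ → E →L[𝕜] E := fun n => (sqrtCoeff n : 𝕜) • B ^ n with hf
  have hfn : ∀ n, ‖f n‖ ≤ sqrtCoeff n := fun n => by
    rw [hf]
    simp only [norm_smul, RCLike.norm_ofReal, abs_of_nonneg (sqrtCoeff_nonneg n)]
    refine mul_le_of_le_one_right (sqrtCoeff_nonneg n) ?_
    cases n with
    | zero => exact norm_id_le
    | succ n => exact (norm_pow_le' _ n.succ_pos).trans (pow_le_one₀ (norm_nonneg _) hT1)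
  have hfs : Summable fun n => ‖f n‖ :=
    summable_sqrtCoeff.of_nonneg_of_le (fun _ => norm_nonneg _) hfn
  have hfs' : Summable f := hfs.of_norm
  set N := ∑' n, f n with hN
  have hNN : N * N = 2 * N - B := by
    rw [hN, tsum_mul_tsum_eq_tsum_sum_antidiagonal_of_summable_norm hfs hfs]
    have h1 : ∀ n, ∑ p ∈ Finset.HasAntidiagonal.antidiagonal n, f p.1 * f p.2 =
        2 * f n - if n = 1 then B else 0 := fun n => by
      have : ∀ p ∈ Finset.HasAntidiagonal.antidiagonal n, f p.1 * f p.2 =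
          ((sqrtCoeff p.1 * sqrtCoeff p.2 : ℝ) : 𝕜) • B ^ n := fun p hp => by
        rw [hf]
        simp only [smul_mul_smul_comm, ← pow_add, Finset.HasAntidiagonal.mem_antidiagonal.1 hp,
          RCLike.ofReal_mul]
      rw [Finset.sum_congr rfl this, ← Finset.sum_smul, ← RCLike.ofReal_sum,
        sum_antidiagonal_sqrtCoeff, RCLike.ofReal_sub, sub_smul, RCLike.ofReal_mul, mul_smul]
      congr 1
      · rw [RCLike.ofReal_ofNat, two_smul, two_mul]
      · split_ifs with h <;> simp [h]
    simp_rw [h1]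
    rw [(hfs'.mul_left 2).tsum_sub (hasSum_ite_eq 1 B).summable, hfs'.tsum_mul_left,
      tsum_ite_eq]
  have hNs : IsSelfAdjoint N := by
    rw [IsSelfAdjoint, hN, tsum_star]
    refine tsum_congr fun n => ?_
    rw [hf]
    simp [star_smul, (hBs.pow n).star_eq]
  refine ⟨1 - N, (IsSelfAdjoint.one _).sub hNs, ?_, ?_, fun C hC => ?_⟩
  · rw [sub_sub_cancel]
    exact (norm_tsum_le_tsum_norm hfs).trans
      ((hfs.tsum_le_tsum hfn summable_sqrtCoeff).trans tsum_sqrtCoeff_le_one)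
  · calc (1 - N) * (1 - N) = 1 - 2 * N + N * N := by noncomm_ring
      _ = T := by rw [hNN, hB]; noncomm_ring
  · refine (Commute.one_right C).sub_right (Commute.tsum_right _ fun n => ?_)
    exact (((Commute.one_right C).sub_right hC).pow_right n).smul_right _

/-- A polar decomposition of a self-adjoint contraction `A`: with `Q = |A|^{1/2}` and `J` a
self-adjoint unitary commuting with `Q`, one has `A = J Q²`. -/
theorem exists_polar {A : E →L[𝕜] E} (hA : IsSelfAdjoint A) (hA1 : ‖A‖ ≤ 1) :
    ∃ Q J : E →L[𝕜] E, IsSelfAdjoint Q ∧ IsSelfAdjoint J ∧ J * J = 1 ∧ J * Q = Q * J ∧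
      A = J * (Q * Q) ∧ ∀ f, A f = 0 → Q f = 0 := by
  have hAA : IsSelfAdjoint (A * A) := by simpa [pow_two] using hA.pow 2
  have hAi : ∀ x y, inner 𝕜 (A x) y = inner 𝕜 x (A y) := fun x y => by
    rw [← adjoint_inner_right, hA.adjoint_eq]
  have hAA1 : ‖1 - A * A‖ ≤ 1 := by
    refine opNorm_le_bound _ zero_le_one fun f => ?_
    have hle : ∀ g, ‖A g‖ ≤ ‖g‖ := fun g =>
      (A.le_opNorm g).trans (mul_le_of_le_one_left (norm_nonneg _) hA1)
    have h1 := @norm_sub_sq 𝕜 _ _ _ _ f (A (A f))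
    rw [← hAi, ← norm_sq_eq_re_inner (𝕜 := 𝕜) (A f)] at h1
    have h2 := hle (A f)
    have : ‖f - A (A f)‖ ^ 2 ≤ ‖f‖ ^ 2 := by
      nlinarith [norm_nonneg (A (A f)), norm_nonneg (A f)]
    simpa using (sq_le_sq₀ (norm_nonneg _) (norm_nonneg _)).1 this
  -- `B = |A|`
  obtain ⟨B, hBs, hB1, hBB, hBc⟩ := exists_isSelfAdjoint_sqrt hAA hAA1
  obtain ⟨Q, hQs, -, hQQ, hQc⟩ := exists_isSelfAdjoint_sqrt hBs hB1
  have hAB : Commute A B := hBc A ((Commute.refl A).mul_right (Commute.refl A))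
  -- `P` is the spectral projection of `A` for `[0, ∞)`.
  set U : Submodule 𝕜 E := LinearMap.ker (B - A : E →L[𝕜] E).toLinearMap with hU
  have hUc : IsClosed (U : Set E) := (B - A).isClosed_ker
  have : CompleteSpace U := hUc.completeSpace_coe
  set P := U.starProjection with hP
  have hPs : IsSelfAdjoint P := isSelfAdjoint_starProjection U
  have hPP : P * P = P := U.isIdempotentElem_starProjection.eq
  have h1 : (B - A) * P = 0 := by
    ext f
    exact (LinearMap.mem_ker.1 (U.starProjection_apply_mem f) :)
  have h1' : P * (B - A) = 0 := by
    simpa [hPs.star_eq, hBs.star_eq, hA.star_eq] using congrArg star h1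
  have h2 : P * (B + A) = B + A := by
    ext f
    refine Submodule.starProjection_eq_self_iff.2 (LinearMap.mem_ker.2 ?_)
    have : (B - A) * (B + A) = 0 := by
      rw [sub_mul, mul_add, mul_add, hBB, hAB.eq]; abel
    exact congrArg (fun T : E →L[𝕜] E => T f) this
  have h2' : (B + A) * P = B + A := by
    simpa [hPs.star_eq, hBs.star_eq, hA.star_eq] using congrArg star h2
  have hPB : P * B = B * P := by
    have e1 : P * B = P * A := by rw [← sub_eq_zero, ← mul_sub, h1']
    have e2 : B * P = A * P := by rw [← sub_eq_zero, ← sub_mul, h1]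
    have e3 : (2 : ℕ) • (P * B) = (2 : ℕ) • (B * P) := by
      rw [two_nsmul, two_nsmul]
      nth_rw 2 [e1]; nth_rw 2 [e2]
      rw [← mul_add, ← add_mul, h2, h2']
    have := congrArg (fun T => (2 : 𝕜)⁻¹ • T) e3
    simpa [← Nat.cast_smul_eq_nsmul 𝕜, smul_smul] using this
  refine ⟨Q, P + P - 1, hQs, (hPs.add hPs).sub (IsSelfAdjoint.one _), ?_, ?_, ?_, ?_⟩
  · calc (P + P - 1) * (P + P - 1) = (P * P + P * P + P * P + P * P) - P - P - P - P + 1 := by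
          noncomm_ring
      _ = 1 := by rw [hPP]; abel
  · have : Commute P Q := hQc P hPB
    rw [sub_mul, mul_sub, add_mul, mul_add, this.eq, one_mul, mul_one]
  · have e1 : P * B = P * A := by rw [← sub_eq_zero, ← mul_sub, h1']
    rw [hQQ, sub_mul, add_mul, one_mul]
    nth_rw 2 [e1]
    rw [← mul_add, h2]; abel
  · intro f hf
    have hB0 : B f = 0 := by
      rw [← inner_self_eq_zero (𝕜 := 𝕜), ← adjoint_inner_right, hBs.adjoint_eq]
      rw [show B (B f) = A (A f) from congrArg (fun T : E →L[𝕜] E => T f) hBB, hf]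
      simp
    rw [← inner_self_eq_zero (𝕜 := 𝕜), ← adjoint_inner_right, hQs.adjoint_eq]
    rw [show Q (Q f) = B f from congrArg (fun T : E →L[𝕜] E => T f) hQQ, hB0]
    simp

end ContinuousLinearMap

/-! ### Kolmogorov decompositions -/

namespace OpKernel

variable {𝕜 : Type u} [RCLike 𝕜] {Y : Type v} {H : Y → HilbertSpc.{u, w} 𝕜}

/-- The Kolmogorov decomposition of a positive semidefinite kernel. Mathlib's Moore theorem is for
kernels with values in the operators on a single Hilbert space, here the `ℓ²`-sum of the bundle. -/
theorem exists_kolmogorov (L : OpKernel H)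
    (hL : ∀ x y, ContinuousLinearMap.adjoint (L x y) = L y x)
    (hpos : ∀ (n : ℕ) (x : Fin n → Y) (h : ∀ i, H (x i)),
      0 ≤ RCLike.re (∑ i, ∑ j, inner 𝕜 (h j) (L (x j) (x i) (h i)))) :
    ∃ (E : Type (max u v w)) (_ : NormedAddCommGroup E) (_ : InnerProductSpace 𝕜 E)
      (_ : CompleteSpace E) (W : ∀ y, H y →L[𝕜] E),
      ∀ x y (h : H x) (k : H y), inner 𝕜 (W x h) (W y k) = inner 𝕜 h (L x y k) := by
  classical
  let F := lp (fun y => H y) 2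
  let π : ∀ y, F →L[𝕜] H y := fun y => lp.evalCLM 𝕜 (fun y => H y) 2 y
  have hπ : ∀ y (h : H y), π y ((π y).adjoint h) = h := fun y h => by
    have : (π y).adjoint h = lp.single 2 y h := by
      refine ext_inner_right 𝕜 fun f => ?_
      rw [ContinuousLinearMap.adjoint_inner_left, lp.inner_single_left]
      rfl
    rw [this]
    exact lp.single_apply_self (E := fun y => H y) 2 y h
  let M : Matrix Y Y (F →L[𝕜] F) := .of fun x y => (π x).adjoint ∘L L x y ∘L π y
  have hM : M.PosSemidef := by
    have htfae := (RKHS.posSemidef_tfae (K := M)).out 0 2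
    refine htfae.2 ⟨?_, fun f => ?_⟩
    · ext x y : 2
      simp only [M, Matrix.conjTranspose_apply, Matrix.of_apply, ContinuousLinearMap.star_eq_adjoint,
        ContinuousLinearMap.adjoint_comp, hL, ContinuousLinearMap.adjoint_adjoint]
      rfl
    · have h1 := hpos f.support.card (fun i => (f.support.equivFin.symm i : Y))
        (fun i => π _ (f (f.support.equivFin.symm i : Y)))
      rw [Finsupp.sum, ← Finset.sum_coe_sort, ← f.support.equivFin.symm.sum_comp]
      simp_rw [Finsupp.sum]
      simp_rw [← Finset.sum_coe_sort f.support, ← f.support.equivFin.symm.sum_comp]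
      rw [← RCLike.conj_re]
      simpa only [map_sum, inner_conj_symm, M, Matrix.of_apply, ContinuousLinearMap.comp_apply,
        ContinuousLinearMap.adjoint_inner_right] using h1
  have : Fact M.PosSemidef := ⟨hM⟩
  refine ⟨RKHS.OfKernel M, inferInstance, inferInstance, inferInstance,
    fun y => RKHS.kerFun (RKHS.OfKernel M) y ∘L (π y).adjoint, fun x y h k => ?_⟩
  rw [ContinuousLinearMap.comp_apply, ContinuousLinearMap.comp_apply, ← inner_conj_symm,
    ← RKHS.kernel_inner, RKHS.OfKernel.kernel_ofKernel, inner_conj_symm]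
  simp only [M, Matrix.of_apply, ContinuousLinearMap.comp_apply,
    ContinuousLinearMap.adjoint_inner_right, hπ]

end OpKernel

/-! ### Krein structures on vector spaces -/

section

variable {𝕜 : Type u} [RCLike 𝕜]

/-- The inner product of a Hilbert space, transported along a linear equivalence. -/
@[reducible] noncomputable def LinearEquiv.innerCore {V E : Type*} [AddCommGroup V] [Module 𝕜 V]
    [NormedAddCommGroup E] [InnerProductSpace 𝕜 E] (e : V ≃ₗ[𝕜] E) :
    InnerProductSpace.Core 𝕜 V where
  inner f g := inner 𝕜 (e f) (e g)
  conj_inner_symm f g := inner_conj_symm _ _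
  re_inner_nonneg f := inner_self_nonneg
  add_left f g h := by rw [map_add, inner_add_left]
  smul_left f g r := by rw [map_smul, inner_smul_left]
  definite f hf := by simpa using hf

/-- With the transported inner product, the equivalence is isometric. -/
noncomputable def LinearEquiv.innerCoreIsometry {V E : Type*} [AddCommGroup V] [Module 𝕜 V]
    [NormedAddCommGroup E] [InnerProductSpace 𝕜 E] (e : V ≃ₗ[𝕜] E) :
    letI : NormedAddCommGroup V := e.innerCore.toNormedAddCommGroup
    V ≃ᵢ E :=
  letI : NormedAddCommGroup V := e.innerCore.toNormedAddCommGroup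
  { e.toEquiv with
    isometry_toFun := by
      refine AddMonoidHomClass.isometry_of_norm e fun f => ?_
      rw [@norm_eq_sqrt_re_inner 𝕜]
      rfl }

/-- The Krein space structure with inner product `[f, g] = ⟨J f, g⟩`, for a self-adjoint unitary `J`
on a Hilbert space, transported along a linear equivalence. -/
noncomputable def KreinStructure.ofEquiv {V E : Type*} [AddCommGroup V] [Module 𝕜 V]
    [NormedAddCommGroup E] [InnerProductSpace 𝕜 E] [CompleteSpace E] (e : V ≃ₗ[𝕜] E)
    (J : E →L[𝕜] E) (hJ : ∀ f g, inner 𝕜 (J f) g = inner 𝕜 f (J g)) (hJJ : ∀ f, J (J f) = f) :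
    KreinStructure 𝕜 V where
  form := LinearMap.mk₂'ₛₗ (RingHom.id 𝕜) (starRingEnd 𝕜)
    (fun f g => inner 𝕜 (e g) (J (e f)))
    (fun f g h => by simp only [map_add, inner_add_right])
    (fun r f g => by simp only [map_smul, inner_smul_right, RingHom.id_apply, smul_eq_mul])
    (fun f g h => by simp only [map_add, inner_add_left])
    (fun r f g => by simp only [map_smul, inner_smul_left, smul_eq_mul])
  form_symm f g := by
    simp only [LinearMap.mk₂'ₛₗ_apply, inner_conj_symm, hJ]
  strongTopology :=
    letI : NormedAddCommGroup V := e.innerCore.toNormedAddCommGroup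
    UniformSpace.toTopologicalSpace
  exists_fundamentalSymmetry := by
    refine ⟨e.symm.toLinearMap ∘ₗ J.toLinearMap ∘ₗ e.toLinearMap, ?_, e.innerCore, ?_, ?_, rfl⟩
    · ext f
      simp [hJJ]
    · intro f g
      change inner 𝕜 (e g) (e f) = inner 𝕜 (e g) (J (e (e.symm (J (e f)))))
      rw [e.apply_symm_apply, hJJ]
    · let _ : NormedAddCommGroup V := e.innerCore.toNormedAddCommGroup
      exact e.innerCoreIsometry.completeSpace

theorem KreinStructure.ofEquiv_isDense {V E : Type*} [AddCommGroup V] [Module 𝕜 V]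
    [NormedAddCommGroup E] [InnerProductSpace 𝕜 E] [CompleteSpace E] (e : V ≃ₗ[𝕜] E)
    (J : E →L[𝕜] E) (hJ : ∀ f g, inner 𝕜 (J f) g = inner 𝕜 f (J g)) (hJJ : ∀ f, J (J f) = f)
    {D : Submodule 𝕜 V} (hD : ∀ f : E, (∀ d ∈ D, inner 𝕜 (e d) f = 0) → f = 0) :
    (KreinStructure.ofEquiv e J hJ hJJ).IsDense D := by
  let _ : NormedAddCommGroup V := e.innerCore.toNormedAddCommGroup
  have h1 : Dense ((D.map e.toLinearMap : Submodule 𝕜 E) : Set E) := by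
    rw [Submodule.dense_iff_topologicalClosure_eq_top, Submodule.topologicalClosure_eq_top_iff,
      Submodule.eq_bot_iff]
    exact fun f hf => hD f fun d hd =>
      (Submodule.mem_orthogonal _ f).1 hf _ (Submodule.mem_map_of_mem hd)
  have h3 : (D : Set V) = e.innerCoreIsometry.symm '' (D.map e.toLinearMap : Submodule 𝕜 E) :=
    (e.toEquiv.symm_image_image (D : Set V)).symm
  change Dense (D : Set V)
  rw [h3]
  exact e.innerCoreIsometry.symm.surjective.denseRange.dense_image
    e.innerCoreIsometry.symm.continuous h1

/-- An operator from a Hilbert space to a Krein space with an everywhere defined adjoint is bounded,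
by the closed graph theorem. -/
theorem KreinStructure.continuous_of_adjoint {V E : Type*} [AddCommGroup V] [Module 𝕜 V]
    [NormedAddCommGroup E] [InnerProductSpace 𝕜 E] [CompleteSpace E] (κ : KreinStructure 𝕜 V)
    (T : E →ₗ[𝕜] V) (T' : V → E) (hT : ∀ f h, inner 𝕜 h (T' f) = κ.form f (T h)) :
    @Continuous E V inferInstance κ.strongTopology T := by
  obtain ⟨J, hJJ, c, hc, hcomp, hτ⟩ := κ.exists_fundamentalSymmetry
  rw [hτ]
  let _ : NormedAddCommGroup V := c.toNormedAddCommGroup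
  let _ : InnerProductSpace 𝕜 V := InnerProductSpace.ofCore c.toCore
  have hform : ∀ f g, κ.form f g = inner 𝕜 g (J f) := fun f g => by
    have : J (J f) = f := congrArg (fun A : V →ₗ[𝕜] V => A f) hJJ
    conv_lhs => rw [← this]
    exact (hc (J f) g).symm
  refine T.continuous_of_seq_closed_graph fun h x g hh hg => ?_
  have key : ∀ f, κ.form f g = κ.form f (T x) := fun f => by
    have h1 : Filter.Tendsto (fun n => κ.form f (T (h n))) Filter.atTop (nhds (κ.form f g)) := by
      simp_rw [hform]
      exact Filter.Tendsto.inner hg tendsto_const_nhds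
    have h2 : Filter.Tendsto (fun n => κ.form f (T (h n))) Filter.atTop
        (nhds (κ.form f (T x))) := by
      simp_rw [← hT]
      exact Filter.Tendsto.inner hh tendsto_const_nhds
    exact tendsto_nhds_unique h1 h2
  rw [← sub_eq_zero, ← inner_self_eq_zero (𝕜 := 𝕜)]
  have := key (J (g - T x))
  rw [← sub_eq_zero, ← map_sub, ← hc] at this
  exact this

end

/-! ### Reproducing kernel Krein spaces of dominated kernels -/

namespace OpKernel

variable {𝕜 : Type u} [RCLike 𝕜] {Y : Type v} {H : Y → HilbertSpc.{u, w} 𝕜}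

/-- A kernel of the form `K(x, y) = V_x^* J V_y` has a reproducing kernel Krein space, the image of
`E` under `f ↦ (V_y^* J f)_y`; minimality makes this map injective. -/
theorem exists_rkKreinSpace_of_linearisation (K : OpKernel H) {E : Type*} [NormedAddCommGroup E]
    [InnerProductSpace 𝕜 E] [CompleteSpace E] (J : E →L[𝕜] E)
    (hJ : ∀ f g, inner 𝕜 (J f) g = inner 𝕜 f (J g)) (hJJ : ∀ f, J (J f) = f)
    (V : ∀ y, H y →L[𝕜] E)
    (hV : ∀ x y (h : H x) (k : H y), inner 𝕜 (V x h) (J (V y k)) = inner 𝕜 h (K x y k))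
    (hmin : ∀ f : E, (∀ y (h : H y), inner 𝕜 (V y h) f = 0) → f = 0) :
    ∃ R : RKKreinSpace K, R.krein.IsDense R.secSpan := by
  let ev : E →ₗ[𝕜] ∀ y, H y := LinearMap.pi fun y => ((V y).adjoint ∘L J).toLinearMap
  have hev : ∀ f y, ev f y = (V y).adjoint (J f) := fun f y => rfl
  have hinj : Function.Injective ev := by
    rw [injective_iff_map_eq_zero]
    intro f hf
    rw [← hJJ f, hmin (J f) fun y h => ?_, map_zero]
    rw [← ContinuousLinearMap.adjoint_inner_right, ← hev, hf, Pi.zero_apply, inner_zero_right]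
  have hsec : ∀ y (h : H y), K.sec y h = ev (V y h) := fun y h => by
    ext1 x
    refine ext_inner_left 𝕜 fun k => ?_
    rw [hev, ContinuousLinearMap.adjoint_inner_right, hV]
    rfl
  let e := LinearEquiv.ofInjective ev hinj
  have hmem : ∀ y (h : H y), K.sec y h ∈ LinearMap.range ev := fun y h => ⟨V y h, (hsec y h).symm⟩
  have he : ∀ y (h : H y), e.symm ⟨K.sec y h, hmem y h⟩ = V y h := fun y h => by
    rw [LinearEquiv.symm_apply_eq]
    exact Subtype.ext (hsec y h)
  refine ⟨⟨LinearMap.range ev, KreinStructure.ofEquiv e.symm J hJ hJJ, hmem, fun f x h => ?_⟩,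
    KreinStructure.ofEquiv_isDense e.symm J hJ hJJ fun f hf => hmin f fun y h => ?_⟩
  · obtain ⟨g, rfl⟩ := e.surjective f
    change _ = inner 𝕜 (e.symm ⟨K.sec x h, hmem x h⟩) (J (e.symm (e g)))
    rw [he, e.symm_apply_apply, ← ContinuousLinearMap.adjoint_inner_right]
    rfl
  · rw [← he]
    exact hf _ (RKKreinSpace.sec_mem_secSpan _ y h)

/-- If `L` and `L - K` are positive semidefinite, then `K` has a minimal Krein space linearisation:
`K` is the Gram kernel of a self-adjoint contraction `A` on a Hilbert space, and the linearisation
is read off from the polar decomposition of `A`. -/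
theorem exists_linearisation (K L : OpKernel H)
    (hL : ∀ x y, ContinuousLinearMap.adjoint (L x y) = L y x)
    (hLpos : ∀ (n : ℕ) (x : Fin n → Y) (h : ∀ i, H (x i)),
      0 ≤ RCLike.re (∑ i, ∑ j, inner 𝕜 (h j) (L (x j) (x i) (h i))))
    (hK : ∀ x y, ContinuousLinearMap.adjoint (L x y - K x y) = L y x - K y x)
    (hKpos : ∀ (n : ℕ) (x : Fin n → Y) (h : ∀ i, H (x i)),
      0 ≤ RCLike.re (∑ i, ∑ j, inner 𝕜 (h j) ((L (x j) (x i) - K (x j) (x i)) (h i)))) :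
    ∃ (E : Type (max u v w)) (_ : NormedAddCommGroup E) (_ : InnerProductSpace 𝕜 E)
      (_ : CompleteSpace E) (J : E →L[𝕜] E) (V : ∀ y, H y →L[𝕜] E),
      (∀ f g, inner 𝕜 (J f) g = inner 𝕜 f (J g)) ∧ (∀ f, J (J f) = f) ∧
      (∀ x y (h : H x) (k : H y), inner 𝕜 (V x h) (J (V y k)) = inner 𝕜 h (K x y k)) ∧
      ∀ f : E, (∀ y (h : H y), inner 𝕜 (V y h) f = 0) → f = 0 := by
  obtain ⟨E₁, _, _, _, W₁, hW₁⟩ := exists_kolmogorov L hL hLpos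
  obtain ⟨E₂, _, _, _, W₂, hW₂⟩ := exists_kolmogorov (fun x y => L x y - K x y) hK hKpos
  let F := WithLp 2 (E₁ × E₂)
  let ι : (E₁ × E₂) ≃L[𝕜] F := (WithLp.prodContinuousLinearEquiv 2 𝕜 E₁ E₂).symm
  let W : ∀ y, H y →L[𝕜] F := fun y => ι.toContinuousLinearMap ∘L (W₁ y).prod (W₂ y)
  -- the symmetry `(f₁, f₂) ↦ (f₁, -f₂)`
  let J₀ : F →L[𝕜] F := ι.toContinuousLinearMap ∘L
    ((ContinuousLinearMap.fst 𝕜 E₁ E₂).prod (-ContinuousLinearMap.snd 𝕜 E₁ E₂)) ∘L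
      ι.symm.toContinuousLinearMap
  have hfst : ∀ f : F, (J₀ f).fst = f.fst := fun _ => rfl
  have hsnd : ∀ f : F, (J₀ f).snd = -f.snd := fun _ => rfl
  have hJ₀s : IsSelfAdjoint J₀ := by
    rw [ContinuousLinearMap.isSelfAdjoint_iff_isSymmetric]
    intro f g
    change inner 𝕜 (J₀ f) g = inner 𝕜 f (J₀ g)
    rw [WithLp.prod_inner_apply, WithLp.prod_inner_apply]
    change inner 𝕜 (J₀ f).fst g.fst + inner 𝕜 (J₀ f).snd g.snd =
      inner 𝕜 f.fst (J₀ g).fst + inner 𝕜 f.snd (J₀ g).snd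
    rw [hfst, hfst, hsnd, hsnd, inner_neg_left, inner_neg_right]
  have hJ₀1 : ‖J₀‖ ≤ 1 := by
    refine ContinuousLinearMap.opNorm_le_bound _ zero_le_one fun f => ?_
    rw [one_mul, WithLp.prod_norm_eq_of_L2, WithLp.prod_norm_eq_of_L2, hfst, hsnd, norm_neg]
  have hWJ₀ : ∀ x y (h : H x) (k : H y), inner 𝕜 (W x h) (J₀ (W y k)) = inner 𝕜 h (K x y k) :=
    fun x y h k => by
      have : inner 𝕜 (W x h) (J₀ (W y k)) =
          inner 𝕜 (W₁ x h) (W₁ y k) - inner 𝕜 (W₂ x h) (W₂ y k) := by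
        rw [WithLp.prod_inner_apply, sub_eq_add_neg, ← inner_neg_right]
        rfl
      rw [this, hW₁, hW₂, sub_apply, inner_sub_right, sub_sub_cancel]
  let U : Submodule 𝕜 F := (Submodule.span 𝕜 {f | ∃ y h, f = W y h}).topologicalClosure
  have hWU : ∀ y h, W y h ∈ U := fun y h =>
    Submodule.le_topologicalClosure _ (Submodule.subset_span ⟨y, h, rfl⟩)
  have : CompleteSpace U := (Submodule.isClosed_topologicalClosure _).completeSpace_coe
  let P := U.starProjection
  have hP : ∀ f ∈ U, P f = f := fun f => Submodule.starProjection_eq_self_iff.2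
  have hPs : IsSelfAdjoint P := isSelfAdjoint_starProjection U
  have hP1 : ‖P‖ ≤ 1 := U.starProjection_norm_le
  let A : F →L[𝕜] F := P * J₀ * P
  have hAs : IsSelfAdjoint A := by
    change star (P * J₀ * P) = P * J₀ * P
    rw [star_mul, star_mul, hPs.star_eq, hJ₀s.star_eq, mul_assoc]
  have hA1 : ‖A‖ ≤ 1 := by
    refine (norm_mul_le _ _).trans (mul_le_one₀ ((norm_mul_le _ _).trans
      (mul_le_one₀ hP1 (norm_nonneg _) hJ₀1)) (norm_nonneg _) hP1)
  obtain ⟨Q, J, hQ, hJ, hJJ, hJQ, hAJ, hker⟩ := ContinuousLinearMap.exists_polar hAs hA1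
  have hQi : ∀ f g, inner 𝕜 (Q f) g = inner 𝕜 f (Q g) := hQ.isSymmetric
  have hJi : ∀ f g, inner 𝕜 (J f) g = inner 𝕜 f (J g) := hJ.isSymmetric
  have hPi : ∀ f g, inner 𝕜 (P f) g = inner 𝕜 f (P g) := hPs.isSymmetric
  -- `Q` vanishes on the orthogonal complement of `U`, as `A` does
  have hQP : ∀ f, Q f = Q (P f) := fun f => by
    have : P (P f) = P f := hP _ (U.starProjection_apply_mem f)
    rw [← sub_eq_zero, ← map_sub]
    refine hker _ ?_
    simp [A, this]
  have hJQ' : ∀ f, J (Q f) = Q (J f) := fun f => congrArg (fun T : F →L[𝕜] F => T f) hJQ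
  let 𝓚 : Submodule 𝕜 F := (Submodule.span 𝕜 {f | ∃ y h, f = Q (W y h)}).topologicalClosure
  have h𝓚c : IsClosed (𝓚 : Set F) := Submodule.isClosed_topologicalClosure _
  have hQW : ∀ y h, Q (W y h) ∈ 𝓚 := fun y h =>
    Submodule.le_topologicalClosure _ (Submodule.subset_span ⟨y, h, rfl⟩)
  have hU𝓚 : ∀ f ∈ U, Q f ∈ 𝓚 := by
    have : U ≤ 𝓚.comap Q.toLinearMap :=
      Submodule.topologicalClosure_minimal _
        (Submodule.span_le.2 (by rintro _ ⟨y, h, rfl⟩; exact hQW y h))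
        (h𝓚c.preimage Q.continuous)
    exact this
  have hJ𝓚 : ∀ f ∈ 𝓚, J f ∈ 𝓚 := by
    have : 𝓚 ≤ 𝓚.comap J.toLinearMap :=
      Submodule.topologicalClosure_minimal _
        (Submodule.span_le.2 (by
          rintro _ ⟨y, h, rfl⟩
          change J (Q (W y h)) ∈ 𝓚
          rw [hJQ', hQP]
          exact hU𝓚 _ (U.starProjection_apply_mem _)))
        (h𝓚c.preimage J.continuous)
    exact this
  refine ⟨𝓚, inferInstance, inferInstance, h𝓚c.completeSpace_coe,
    (J ∘L 𝓚.subtypeL).codRestrict 𝓚 fun f => hJ𝓚 _ f.2,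
    fun y => (Q ∘L W y).codRestrict 𝓚 (hQW y), fun f g => hJi f g,
    fun f => Subtype.ext (congrArg (fun T : F →L[𝕜] F => T f) hJJ), fun x y h k => ?_,
    fun f hf => ?_⟩
  · change inner 𝕜 (Q (W x h)) (J (Q (W y k))) = _
    rw [hQi, ← hJQ', show J (Q (Q (W y k))) = A (W y k) by rw [hAJ]; rfl]
    change inner 𝕜 (W x h) (P (J₀ (P (W y k)))) = _
    rw [← hPi, hP _ (hWU x h), hP _ (hWU y k), hWJ₀]
  · have h1 : 𝓚 ≤ (𝕜 ∙ (f : F))ᗮ :=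
      Submodule.topologicalClosure_minimal _
        (Submodule.span_le.2 (by
          rintro _ ⟨y, h, rfl⟩
          exact Submodule.mem_orthogonal_singleton_iff_inner_left.2 (hf y h)))
        (Submodule.isClosed_orthogonal _)
    exact Subtype.ext (inner_self_eq_zero.1
      (Submodule.mem_orthogonal_singleton_iff_inner_left.1 (h1 f.2)))

end OpKernel

/-! ### Identifications along orbits -/

namespace HilbertSpc

variable {𝕜 : Type u} [RCLike 𝕜]

theorem inner_cast_right {A B : HilbertSpc.{u, w} 𝕜} (e : A = B) (a : A) (b : B) :
    inner 𝕜 b (cast e a) = inner 𝕜 (cast e.symm b) a := by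
  subst e; rfl

theorem cast_cast {A B C : HilbertSpc.{u, w} 𝕜} (e : A = B) (e' : B = C) (a : A) :
    cast e' (cast e a) = cast (e.trans e') a := by
  subst e; rfl

theorem cast_section {Y : Type v} {H : Y → HilbertSpc.{u, w} 𝕜} (f : ∀ y, H y) {x y : Y}
    (hxy : x = y) {B : HilbertSpc.{u, w} 𝕜} (ex : H x = B) (ey : H y = B) :
    cast ex (f x) = cast ey (f y) := by
  subst hxy; rfl

end HilbertSpc

theorem StarSemigroupoid.starHom_starHom {Γ S : Type*} (G : StarSemigroupoid Γ S) {s t : S}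
    (α : G.Hom s t) : G.starHom (G.starHom α) = α :=
  Subtype.ext (G.star_star α.1)

theorem StarSemigroupoid.starHom_comp {Γ S : Type*} (G : StarSemigroupoid Γ S) {s t r : S}
    (α : G.Hom t r) (β : G.Hom s t) :
    G.starHom (α.comp β) = (G.starHom β).comp (G.starHom α) :=
  Subtype.ext (G.star_mul α.1 β.1 _)

theorem LeftAction.comp_smul {Γ S X : Type*} {G : Semigroupoid Γ S} (A : LeftAction G X)
    {s t r : S} (α : G.Hom t r) (β : G.Hom s t) (x : A.Fiber s) :
    A.smul (α.comp β) x = A.smul α (A.smul β x) :=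
  Subtype.ext (A.act_mul α.1 β.1 x.1 _ _)

/-! ### The translation operators on sections -/

section Shift

variable {𝕜 : Type u} [RCLike 𝕜] {Γ S : Type*} {G : StarSemigroupoid Γ S} {X : Type v}
  {A : LeftAction G.toSemigroupoid X} {H : X → HilbertSpc.{u, w} 𝕜}

/-- The operator `f ↦ (f(α^* · y))_y` from the sections of `H` over `X_s` to those over `X_t`. On
the sections `K_x h` of an invariant kernel it acts as `K_x h ↦ K_{α · x} h`; being defined on all
sections, it makes the latter assignment well defined on linear combinations. -/
noncomputable def LeftAction.ConstOnOrbits.shift (hH : A.ConstOnOrbits H) {s t : S}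
    (α : G.Hom s t) : (∀ x : A.Fiber s, H x.1) →ₗ[𝕜] (∀ y : A.Fiber t, H y.1) :=
  LinearMap.pi fun y =>
    (HilbertSpc.cast (hH (G.starHom α) y)).toLinearEquiv.toLinearMap ∘ₗ
      LinearMap.proj (A.smul (G.starHom α) y)

variable (hH : A.ConstOnOrbits H)

theorem LeftAction.ConstOnOrbits.shift_apply {s t : S} (α : G.Hom s t)
    (f : ∀ x : A.Fiber s, H x.1) (y : A.Fiber t) :
    hH.shift α f y = HilbertSpc.cast (hH (G.starHom α) y) (f (A.smul (G.starHom α) y)) :=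
  rfl

theorem LeftAction.ConstOnOrbits.shift_comp {s t r : S} (α : G.Hom t r) (β : G.Hom s t)
    (f : ∀ x : A.Fiber s, H x.1) : hH.shift (α.comp β) f = hH.shift α (hH.shift β f) := by
  ext1 y
  have hy : A.smul (G.starHom (α.comp β)) y =
      A.smul (G.starHom β) (A.smul (G.starHom α) y) := by
    rw [G.starHom_comp, A.comp_smul]
  rw [hH.shift_apply, hH.shift_apply, hH.shift_apply, HilbertSpc.cast_cast]
  exact HilbertSpc.cast_section f hy _ _

variable {hH} {K : OpKernel H}

theorem OpKernel.Invariant.shift_sec (hK : K.Invariant A hH) {s t : S} (α : G.Hom s t)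
    (x : A.Fiber s) (h : H x.1) :
    hH.shift α ((K.restrict A s).sec x h) =
      (K.restrict A t).sec (A.smul α x) (HilbertSpc.cast (hH α x).symm h) := by
  ext1 y
  have hα : ∀ β : G.Hom s t, β = α →
      K y.1 (A.smul β x).1 (HilbertSpc.cast (hH β x).symm h) =
        K y.1 (A.smul α x).1 (HilbertSpc.cast (hH α x).symm h) := by
    rintro _ rfl; rfl
  exact (hK (G.starHom α) y x h).trans (hα _ (G.starHom_starHom α))

theorem OpKernel.Invariant.exists_shift_eq (hK : K.Invariant A hH)
    (R : ∀ s : S, RKKreinSpace (K.restrict A s)) {s t : S} (α : G.Hom s t) (f : (R s).space)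
    (hf : f ∈ (R s).secSpan) : ∃ g ∈ (R t).secSpan, (g : ∀ y : A.Fiber t, H y.1) =
      hH.shift α f := by
  induction hf using Submodule.span_induction with
  | mem f hf =>
    obtain ⟨x, h, rfl⟩ := hf
    exact ⟨_, (R t).sec_mem_secSpan (A.smul α x) (HilbertSpc.cast (hH α x).symm h),
      (hK.shift_sec α x h).symm⟩
  | zero => exact ⟨0, zero_mem _, by simp⟩
  | add f₁ f₂ _ _ h₁ h₂ =>
    obtain ⟨g₁, hg₁, e₁⟩ := h₁
    obtain ⟨g₂, hg₂, e₂⟩ := h₂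
    exact ⟨g₁ + g₂, add_mem hg₁ hg₂, by simp [e₁, e₂]⟩
  | smul c f _ h =>
    obtain ⟨g, hg, e⟩ := h
    exact ⟨c • g, Submodule.smul_mem _ c hg, by simp [e]⟩

/-- The operator `K_x h ↦ K_{α · x} h` between reproducing kernel Krein spaces. -/
noncomputable def OpKernel.Invariant.op (hK : K.Invariant A hH)
    (R : ∀ s : S, RKKreinSpace (K.restrict A s)) {s t : S} (α : G.Hom s t) :
    (R s).secSpan →ₗ[𝕜] (R t).space :=
  (hH.shift α ∘ₗ (R s).space.subtype ∘ₗ (R s).secSpan.subtype).codRestrict (R t).space fun f => by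
    obtain ⟨g, -, hg⟩ := hK.exists_shift_eq R α f.1 f.2
    exact hg ▸ g.2

theorem OpKernel.Invariant.op_mem (hK : K.Invariant A hH)
    (R : ∀ s : S, RKKreinSpace (K.restrict A s)) {s t : S} (α : G.Hom s t)
    (f : (R s).secSpan) : hK.op R α f ∈ (R t).secSpan := by
  obtain ⟨g, hg, e⟩ := hK.exists_shift_eq R α f.1 f.2
  rwa [show hK.op R α f = g from Subtype.ext e.symm]

theorem OpKernel.Invariant.op_sec (hK : K.Invariant A hH)
    (R : ∀ s : S, RKKreinSpace (K.restrict A s)) {s t : S} (α : G.Hom s t) (x : A.Fiber s)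
    (h : H x.1) : hK.op R α ⟨(R s).sec x h, (R s).sec_mem_secSpan x h⟩ =
      (R t).sec (A.smul α x) (HilbertSpc.cast (hH α x).symm h) :=
  Subtype.ext (hK.shift_sec α x h)

/-- By the reproducing property, `Φ(α^*)` is the restriction of the adjoint of `Φ(α)`. -/
theorem OpKernel.Invariant.isSharp_op (hK : K.Invariant A hH)
    (R : ∀ s : S, RKKreinSpace (K.restrict A s)) {s t : S} (α : G.Hom s t) (y : (R t).space)
    (hy : y ∈ (R t).secSpan) :
    IsSharp (R s).krein (R t).krein (hK.op R α) y (hK.op R (G.starHom α) ⟨y, hy⟩) := by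
  intro f
  induction hy using Submodule.span_induction with
  | mem y hy =>
    obtain ⟨x, k, rfl⟩ := hy
    rw [hK.op_sec R]
    refine ((R t).reproducing _ x k).symm.trans (.trans ?_ ((R s).reproducing _ _ _))
    exact HilbertSpc.inner_cast_right _ _ _
  | zero =>
    rw [map_zero]
    exact (map_zero ((R s).krein.form f ∘ₛₗ hK.op R (G.starHom α))).symm
  | add y₁ y₂ h₁ h₂ e₁ e₂ =>
    rw [map_add, e₁, e₂]
    exact (map_add ((R s).krein.form f ∘ₛₗ hK.op R (G.starHom α)) ⟨y₁, h₁⟩ ⟨y₂, h₂⟩).symm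
  | smul c y h e =>
    rw [map_smulₛₗ, e]
    exact (map_smulₛₗ ((R s).krein.form f ∘ₛₗ hK.op R (G.starHom α)) c ⟨y, h⟩).symm

/-- The generalised `*`-representation of `Γ` on the reproducing kernel Krein spaces of an
invariant kernel. -/
noncomputable def OpKernel.Invariant.genStarRep (hK : K.Invariant A hH)
    (R : ∀ s : S, RKKreinSpace (K.restrict A s)) (hR : ∀ s, (R s).krein.IsDense (R s).secSpan) :
    GenStarRep G (fun s => (R s).krein) (fun s => (R s).secSpan) where
  dense := hR
  op α := hK.op R α
  op_memSharp α := ⟨hK.op_mem R α, fun y hy => ⟨_, hK.op_mem R _ _, hK.isSharp_op R α y hy⟩⟩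
  op_comp α β _ := Subtype.ext (hH.shift_comp α β _)
  op_star α y := hK.isSharp_op R α y.1 y.2

end Shift

/-! ### Linearisations give invariance and a dominating kernel -/

theorem OpKernel.invariant_of_genStarRep {𝕜 : Type u} [RCLike 𝕜] {Γ S : Type*}
    {G : StarSemigroupoid Γ S} {X : Type v} {A : LeftAction G.toSemigroupoid X}
    {H : X → HilbertSpc.{u, w} 𝕜} (hH : A.ConstOnOrbits H) {K : OpKernel H} {𝒦 : S → Type*}
    [∀ s, AddCommGroup (𝒦 s)] [∀ s, Module 𝕜 (𝒦 s)] {κ : ∀ s, KreinStructure 𝕜 (𝒦 s)}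
    {D : ∀ s, Submodule 𝕜 (𝒦 s)} (V : MinimalKreinLinearisation A K κ) (Φ : GenStarRep G κ D)
    (hΦ : ∀ ⦃s t : S⦄ (α : G.Hom s t) (x : A.Fiber s) (h : H x.1), ∃ hD : V.V x h ∈ D s,
      Φ.op α ⟨V.V x h, hD⟩ = V.V (A.smul α x) (HilbertSpc.cast (hH α x).symm h)) :
    K.Invariant A hH := by
  intro s t α x y k
  refine ext_inner_left 𝕜 fun h => ?_
  obtain ⟨hx, ex⟩ := hΦ α x h
  obtain ⟨hy, ey⟩ := hΦ (G.starHom α) y k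
  have := Φ.op_star α ⟨V.V y k, hy⟩ ⟨V.V x h, hx⟩
  rw [HilbertSpc.inner_cast_right, V.kernel_eq, V.kernel_eq, ← ex, ← ey, (κ t).form_symm, this,
    ← (κ s).form_symm]

/-- Operators `T_y` into a Krein space give the positive semidefinite kernel `L(x, y) = T_x^* T_y`,
with the adjoint taken in the Hilbert space inner product of a fundamental symmetry. It dominates
`T_x^♯ T_y`, since `[v, v] ≤ ‖v‖²`. -/
theorem KreinStructure.exists_dominating {𝕜 : Type u} [RCLike 𝕜] {V : Type*} [AddCommGroup V]
    [Module 𝕜 V] (κ : KreinStructure 𝕜 V) {Y : Type v} {H : Y → HilbertSpc.{u, w} 𝕜}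
    (T : ∀ y, H y →ₗ[𝕜] V)
    (hT : ∀ y, @Continuous (H y) V inferInstance κ.strongTopology (T y)) :
    ∃ L : OpKernel H, (∀ x y, ContinuousLinearMap.adjoint (L x y) = L y x) ∧
      (∀ (n : ℕ) (x : Fin n → Y) (h : ∀ i, H (x i)),
        0 ≤ RCLike.re (∑ i, ∑ j, inner 𝕜 (h j) (L (x j) (x i) (h i)))) ∧
      ∀ (n : ℕ) (x : Fin n → Y) (h : ∀ i, H (x i)),
        RCLike.re (∑ i, ∑ j, κ.form (T (x i) (h i)) (T (x j) (h j))) ≤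
          RCLike.re (∑ i, ∑ j, inner 𝕜 (h j) (L (x j) (x i) (h i))) := by
  obtain ⟨J, hJJ, c, hc, hcomp, hτ⟩ := κ.exists_fundamentalSymmetry
  rw [hτ] at hT
  let _ : NormedAddCommGroup V := c.toNormedAddCommGroup
  let _ : InnerProductSpace 𝕜 V := InnerProductSpace.ofCore c.toCore
  have : CompleteSpace V := hcomp
  have hform : ∀ f g, inner 𝕜 g f = κ.form (J f) g := hc
  have hJ : ∀ f, J (J f) = f := fun f => congrArg (fun A : V →ₗ[𝕜] V => A f) hJJ
  have hJn : ∀ f, ‖J f‖ = ‖f‖ := fun f => by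
    rw [← sq_eq_sq₀ (norm_nonneg _) (norm_nonneg _), @norm_sq_eq_re_inner 𝕜,
      @norm_sq_eq_re_inner 𝕜, hform, hJ, κ.form_symm, ← hform, RCLike.conj_re]
  have hle : ∀ f, RCLike.re (κ.form f f) ≤ RCLike.re (inner 𝕜 f f) := fun f => by
    have h1 : κ.form f f = inner 𝕜 f (J f) := by rw [hform, hJ]
    rw [h1, ← norm_sq_eq_re_inner]
    refine (RCLike.re_le_norm _).trans ((norm_inner_le_norm _ _).trans ?_)
    rw [hJn, pow_two]
  let W : ∀ y, H y →L[𝕜] V := fun y => ⟨T y, hT y⟩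
  have hsum : ∀ (n : ℕ) (x : Fin n → Y) (h : ∀ i, H (x i)),
      ∑ i, ∑ j, inner 𝕜 (h j) (((W (x j)).adjoint ∘L W (x i)) (h i)) =
        inner 𝕜 (∑ i, T (x i) (h i)) (∑ i, T (x i) (h i)) := fun n x h => by
    rw [inner_sum]
    refine Finset.sum_congr rfl fun i _ => ?_
    rw [sum_inner]
    refine Finset.sum_congr rfl fun j _ => ?_
    rw [ContinuousLinearMap.comp_apply, ContinuousLinearMap.adjoint_inner_right]
    rfl
  refine ⟨fun x y => (W x).adjoint ∘L W y, fun x y => ?_, fun n x h => ?_, fun n x h => ?_⟩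
  · rw [ContinuousLinearMap.adjoint_comp, ContinuousLinearMap.adjoint_adjoint]
  · rw [hsum]
    exact inner_self_nonneg
  · rw [hsum]
    refine le_trans (le_of_eq ?_) (hle _)
    simp only [map_sum, LinearMap.sum_apply]
    exact Finset.sum_comm

theorem MinimalKreinLinearisation.exists_dominating {𝕜 : Type u} [RCLike 𝕜] {Γ S : Type*}
    {G : Semigroupoid Γ S} {X : Type v} {A : LeftAction G X} {H : X → HilbertSpc.{u, w} 𝕜}
    {K : OpKernel H} {𝒦 : S → Type*} [∀ s, AddCommGroup (𝒦 s)] [∀ s, Module 𝕜 (𝒦 s)]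
    {κ : ∀ s, KreinStructure 𝕜 (𝒦 s)} (V : MinimalKreinLinearisation A K κ)
    (hK : K.PartiallyHermitian A) :
    ∃ L : OpKernel H, L.PartiallyPosSemidef A ∧ K.PartiallyDominatedBy L A := by
  classical
  choose L hLs hLpos hLK using fun s => (κ s).exists_dominating (fun x : A.Fiber s => V.V x)
    fun x => V.bounded x
  -- the kernels on the fibres `X_s`, extended by zero
  let M : OpKernel H := fun x y =>
    if e : A.anchor y = A.anchor x then L (A.anchor x) ⟨x, rfl⟩ ⟨y, e⟩ else 0
  have hM : ∀ (s : S) (x y : A.Fiber s), M x.1 y.1 = L s x y := by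
    rintro s ⟨x, rfl⟩ ⟨y, hy⟩
    exact dif_pos hy
  have hMs : M.PartiallyHermitian A := fun s x y => by rw [hM, hM, hLs]
  refine ⟨M, ⟨hMs, fun s n x h => ?_⟩, fun s x y => ?_, fun s n x h => ?_⟩
  · simp_rw [hM]
    exact hLpos s n x h
  · simp only [map_sub, hMs s x y, hK s x y]
  · simp only [hM, sub_apply, inner_sub_right, Finset.sum_sub_distrib, map_sub,
      sub_nonneg]
    refine le_trans (le_of_eq ?_) (hLK s n x h)
    simp only [V.kernel_eq]

/-- A reproducing kernel Krein space with dense span of sections is a minimal linearisation. -/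
def RKKreinSpace.minimalLinearisation {𝕜 : Type u} [RCLike 𝕜] {Γ S : Type*} {G : Semigroupoid Γ S}
    {X : Type v} {A : LeftAction G X} {H : X → HilbertSpc.{u, w} 𝕜} {K : OpKernel H}
    (R : ∀ s : S, RKKreinSpace (K.restrict A s)) (hR : ∀ s, (R s).krein.IsDense (R s).secSpan) :
    MinimalKreinLinearisation A K (fun s => (R s).krein) where
  V {s} x := (R s).sec x
  bounded {s} x := (R s).krein.continuous_of_adjoint ((R s).sec x) (fun f => f.1 x)
    fun f h => (R s).reproducing f x h
  kernel_eq {s} x y h k := (R s).reproducing ((R s).sec y k) x h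
  minimal s := hR s

/-! ### The equivalence -/

theorem theoremt {𝕜 : Type u} [RCLike 𝕜] {Γ S : Type*} (G : StarSemigroupoid Γ S)
    {X : Type v} (A : LeftAction G.toSemigroupoid X) (H : X → HilbertSpc.{u, w} 𝕜)
    (hH : A.ConstOnOrbits H) (K : OpKernel H) (hK : K.PartiallyHermitian A) :
    List.TFAE [
      K.Invariant A hH ∧
        ∃ L : OpKernel H, L.PartiallyPosSemidef A ∧ K.PartiallyDominatedBy L A,
      ∃ (R : ∀ s : S, RKKreinSpace (K.restrict A s))
        (Φ : GenStarRep G (fun s => (R s).krein) (fun s => (R s).secSpan)),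
        ∀ ⦃s t : S⦄ (α : G.Hom s t) (x : A.Fiber s) (h : H x.1),
          Φ.op α ⟨(R s).sec x h, (R s).sec_mem_secSpan x h⟩ =
            (R t).sec (A.smul α x) (HilbertSpc.cast (hH α x).symm h),
      ∃ (𝒦 : S → Type (max v w)) (_ : ∀ s, AddCommGroup (𝒦 s)) (_ : ∀ s, Module 𝕜 (𝒦 s))
        (κ : ∀ s, KreinStructure 𝕜 (𝒦 s)) (D : ∀ s, Submodule 𝕜 (𝒦 s))
        (V : MinimalKreinLinearisation A K κ) (Φ : GenStarRep G κ D),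
        ∀ ⦃s t : S⦄ (α : G.Hom s t) (x : A.Fiber s) (h : H x.1),
          ∃ hD : V.V x h ∈ D s,
            Φ.op α ⟨V.V x h, hD⟩ = V.V (A.smul α x) (HilbertSpc.cast (hH α x).symm h)] := by
  tfae_have 1 → 2 := by
    rintro ⟨hinv, L, ⟨hLs, hLpos⟩, hKs, hKpos⟩
    have hR : ∀ s : S, ∃ R : RKKreinSpace (K.restrict A s), R.krein.IsDense R.secSpan :=
      fun s => by
        obtain ⟨E, _, _, _, J, V, hJ, hJJ, hV, hmin⟩ :=
          OpKernel.exists_linearisation (K.restrict A s) (L.restrict A s) (hLs s) (hLpos s)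
            (hKs s) (hKpos s)
        exact OpKernel.exists_rkKreinSpace_of_linearisation _ J hJ hJJ V hV hmin
    choose R hR using hR
    exact ⟨R, hinv.genStarRep R hR, fun s t α x h => hinv.op_sec R α x h⟩
  tfae_have 2 → 3 := by
    rintro ⟨R, Φ, hΦ⟩
    exact ⟨fun s => (R s).space, inferInstance, inferInstance, fun s => (R s).krein,
      fun s => (R s).secSpan, RKKreinSpace.minimalLinearisation R Φ.dense, Φ,
      fun s t α x h => ⟨(R s).sec_mem_secSpan x h, hΦ α x h⟩⟩
  tfae_have 3 → 1 := by
    rintro ⟨𝒦, _, _, κ, D, V, Φ, hΦ⟩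
    exact ⟨OpKernel.invariant_of_genStarRep hH V Φ hΦ, V.exists_dominating hK⟩
  tfae_finish
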